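/- Let $b\ge 2$ and $m\ge 1$ be integers, and let $s_b(n)$ denote the sum of the digits of $n$ in base $b$. The generalized Thue--Morse word $\mathbf t_{b,m}$ is the infinite word over $\mathbb Z/m\mathbb Z$ whose letter at position $n$ ($n = 0, 1, 2, \ldots$) is $s_b(n) \bmod m$. Assume that $\mathbf t_{b,m}$ is aperiodic, i.e. not of the form $uvvv\cdots$ for finite words $u$ and $v$ with $v$ nonempty. Let $q$ be the order of the permutation $\pi(k)=k+b-1$ of $\mathbb Z/m\mathbb Z$, that is, the least positive integer such that $q(b-1)\equiv 0 \pmod m$. Let $C(n)$ be the number of distinct factors (blocks of consecutive letters) of length $n$ of $\mathbf t_{b,m}$, and let $\Delta(n)=C(n)-C(n-1)$ for $n\ge 1$. Then for $n\ge 2$ the function $\Delta(n)$ takes exactly the two values $(q-1)m$ and $qm$. More precisely: 1. $\Delta(1)=m-1$ and $C(1)=m$. 2. If $2\le n\le b+1$, then $\Delta(n)=(q-1)m$ and $C(n)=qm(n-1)-m(n-2)$. 3. If $n=b^{k+1}+\ell+1$ with $k\ge 0$ and $1\le \ell\le b^{k+1}-b^k$, then $\Delta(n)=qm$ and $C(n)=qm(n-1)-m(b^{k+1}-b^k)$.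 4. If $n=2b^{k+1}-b^k+\ell+1$ with $k\ge 0$ and $1\le \ell\le b^{k+2}-2b^{k+1}+b^k$, then $\Delta(n)=(q-1)m$ and $C(n)=qm(n-1)-m(b^{k+1}-b^k+\ell)$. Every integer $n\ge b+2$ is of the form in 3 or 4, so these cases cover all $n\ge 1$. -/

import Mathlib

/-- The generalized Thue–Morse word `t_{b,m}`: its letter at position `n` (positions start at `0`) is
the sum of the base-`b` digits of `n`, reduced modulo `m`. -/
def gtmWord (b m : ℕ) : ℕ → ZMod m :=
  fun n => ((Nat.digits b n).sum : ZMod m)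

/-- An infinite word is ultimately periodic if it has the form `u v v v ⋯` with `v` nonempty
(here `u` has length `N` and `v` has length `p`). -/
def IsUltimatelyPeriodic {A : Type*} (x : ℕ → A) : Prop :=
  ∃ N p : ℕ, 0 < p ∧ ∀ n, N ≤ n → x (n + p) = x n

/-- The set of factors of length `n` of the infinite word `x`. -/
def factorSet {A : Type*} (x : ℕ → A) (n : ℕ) : Set (Fin n → A) :=
  {w | ∃ i : ℕ, ∀ j : Fin n, w j = x (i + j)}

/-- The factor complexity function `C(n)` of the infinite word `x`. -/
noncomputable def factorComplexity {A : Type*} (x : ℕ → A) (n : ℕ) : ℕ :=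
  (factorSet x n).ncard

/-- The first difference function: `Δ(0) = 1` and `Δ(n) = C(n) - C(n - 1)` for `n ≥ 1`. -/
noncomputable def firstDifference {A : Type*} (x : ℕ → A) : ℕ → ℤ
  | 0 => 1
  | n + 1 => (factorComplexity x (n + 1) : ℤ) - (factorComplexity x n : ℤ)

/-- The permutation `π(k) = k + b - 1` of `ℤ/mℤ`. -/
def gtmPerm (b m : ℕ) : Equiv.Perm (ZMod m) :=
  Equiv.addRight ((b : ZMod m) - 1)

/-- The order `q` of the permutation `π`. -/
noncomputable def gtmOrder (b m : ℕ) : ℕ :=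
  orderOf (gtmPerm b m)

/-!
Write `t` for the generalized Thue–Morse word and `e n` for `t (n + 1) - t n - 1`. Passing from `n`
to `n + 1` turns `v` trailing digits `b - 1` into zeros, where `b ^ v` is the largest power of `b`
dividing `n + 1`, so `e n = v • g` with `g = 1 - b`: the word `e` is the ruler word in base `b`,
with values read modulo the order `q` of `g` (`IsRulerWord`, `isRulerWord_gtmDiff`). A factor of `t`
is given by its first letter and by the corresponding factor of `e`, and the first letter can be
prescribed freely by putting further digits in front of the position. Hence `C (n + 1) = m * P n`,
where `P` is the complexity of `e` (`factorComplexity_gtmWord_succ`). The word `t` is periodic if `g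
= 0`, so aperiodicity gives `g ≠ 0`.

To compute `P (b * M + s)` with `s < b`, sort the windows of this length by their starting position
modulo `b`. The letters of `e` at positions not congruent to `-1` vanish, and those at the remaining
positions spell `e` again, shifted by `g`. So a residue class contributes as many words as there are
factors of `e` of length `M + 1` (for `s` classes) or `M` (for `b - s` classes). A nonzero letter
shows the residue class, hence only the zero word can be counted several times; it occurs in exactly
those classes whose windows contain at most one special position, since of two consecutive special
positions one carries the letter `g ≠ 0`. This gives the recurrence
`IsRulerWord.factorComplexity_mul_add`. For `M ≥ 2` it has no correction term and maps affine pieces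
of `P` on `[u, v]` to affine pieces on `[b * u, b * v]`
(`IsRulerWord.factorComplexity_affine_scale`); with the initial values `P 0 = 1` and `P 1 = q`, and
the correction terms for `M ≤ 1`, it yields the piecewise affine closed forms
`factorComplexity_of_le`, `factorComplexity_steep` and `factorComplexity_flat`, whose slopes
`q - 1` and `q` are the values of `Δ` divided by `m`.
-/

/-! ### Ruler words -/

/-- An abstract ruler word in base `b`: a word with values in an additive group that vanishes at the
positions not congruent to `-1` modulo `b`, and whose subword along the positions `b * n + (b - 1)`
is the word itself shifted by `g`. Equivalently, `e n = v • g` where `b ^ v` is the largest power of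
`b` dividing `n + 1`. -/
structure IsRulerWord {G : Type*} [AddCommGroup G] (b : ℕ) (g : G) (e : ℕ → G) : Prop where
  eq_zero : ∀ n r, r + 1 < b → e (b * n + r) = 0
  eq_add : ∀ n, e (b * n + (b - 1)) = e n + g

/-- The factors of length `N` of `e` that occur at a position congruent to `b - 1 - p` modulo `b`.
The shift is chosen so that, for `p < b`, the letters of such a factor which are not forced to
vanish in a ruler word are those at the indices `p`, `p + b`, `p + 2 * b`, .... -/
def phaseFactors {G : Type*} (b : ℕ) (e : ℕ → G) (N p : ℕ) : Set (Fin N → G) :=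
  {w | ∃ i : ℕ, ∀ j : Fin N, w j = e (b * i + (b - 1 - p) + j)}

theorem factorSet_eq_iUnion_phaseFactors {G : Type*} {b : ℕ} (hb : 2 ≤ b) (e : ℕ → G) (N : ℕ) :
    factorSet e N = ⋃ p : Fin b, phaseFactors b e N p := by
  ext w
  simp only [Set.mem_iUnion, phaseFactors, factorSet, Set.mem_ofPred_eq]
  constructor
  · rintro ⟨i, hi⟩
    have hr : i % b < b := Nat.mod_lt _ (by omega)
    refine ⟨⟨b - 1 - i % b, by omega⟩, i / b, fun j => ?_⟩
    have h1 : b - 1 - (b - 1 - i % b) = i % b := by omega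
    simp only [h1, Nat.div_add_mod]
    exact hi j
  · rintro ⟨p, i, hi⟩
    exact ⟨_, hi⟩

theorem factorComplexity_zero {A : Type*} (x : ℕ → A) : factorComplexity x 0 = 1 := by
  have : factorSet x 0 = Set.univ := by
    ext w
    simp [factorSet]
  simp [factorComplexity, this, Set.ncard_univ]

theorem ncard_diff_zero_add {α : Type*} [Finite α] [Zero α] (s : Set α) (P : Prop) [Decidable P]
    (hP : (0 : α) ∈ s ↔ P) : (s \ {0}).ncard + (if P then 1 else 0) = s.ncard := by
  split_ifs with hif
  · exact Set.ncard_sdiff_singleton_add_one (hP.2 hif)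
  · rw [Set.sdiff_singleton_eq_self (fun h0 => hif (hP.1 h0)), add_zero]

namespace IsRulerWord

variable {G : Type*} [AddCommGroup G] {b : ℕ} {g : G} {e : ℕ → G}

theorem apply_special (h : IsRulerWord b g e) {p : ℕ} (hp : p < b) (i x : ℕ) :
    e (b * i + (b - 1 - p) + (p + b * x)) = e (i + x) + g := by
  rw [← h.eq_add]
  congr 1
  rw [mul_add]
  omega

theorem apply_not_special (h : IsRulerWord b g e) {p : ℕ} (hp : p < b) (i j : ℕ)
    (hj : ∀ x, j ≠ p + b * x) : e (b * i + (b - 1 - p) + j) = 0 := by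
  have hr : (b - 1 - p + j) % b < b := Nat.mod_lt _ (by omega)
  have hd := Nat.div_add_mod (b - 1 - p + j) b
  have hne : (b - 1 - p + j) % b ≠ b - 1 := by
    intro hc
    apply hj ((b - 1 - p + j) / b)
    omega
  have : b * i + (b - 1 - p) + j
      = b * (i + (b - 1 - p + j) / b) + (b - 1 - p + j) % b := by
    rw [mul_add]; omega
  rw [this]
  exact h.eq_zero _ _ (by omega)

theorem exists_eq_nsmul (h : IsRulerWord b g e) (hb : 2 ≤ b) (k : ℕ) : ∃ i, e i = k • g := by
  induction k with
  | zero => exact ⟨0, by simpa using h.eq_zero 0 0 (by omega)⟩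
  | succ k ih =>
    obtain ⟨i, hi⟩ := ih
    exact ⟨b * i + (b - 1), by rw [h.eq_add, hi, succ_nsmul]⟩

theorem mem_multiples (h : IsRulerWord b g e) (hb : 2 ≤ b) (n : ℕ) :
    e n ∈ AddSubmonoid.multiples g := by
  induction n using Nat.strong_induction_on with
  | _ n ih =>
    have hr : n % b < b := Nat.mod_lt _ (by omega)
    have hd := Nat.div_add_mod n b
    by_cases hc : n % b = b - 1
    · rw [← hd, hc, h.eq_add]
      refine add_mem (ih _ ?_) (AddSubmonoid.mem_multiples g)
      exact Nat.div_lt_self (Nat.pos_of_ne_zero (by rintro rfl; simp at hc; omega)) (by omega)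
    · rw [← hd, h.eq_zero _ _ (by omega)]
      exact zero_mem _

theorem factorComplexity_one [Finite G] (h : IsRulerWord b g e) (hb : 2 ≤ b) :
    factorComplexity e 1 = addOrderOf g := by
  have him : (fun w : Fin 1 → G => w 0) '' factorSet e 1 = (AddSubmonoid.multiples g : Set G) := by
    ext y
    constructor
    · rintro ⟨w, ⟨i, hi⟩, rfl⟩
      simp only [hi]
      exact h.mem_multiples hb _
    · rintro ⟨k, rfl⟩
      obtain ⟨i, hi⟩ := h.exists_eq_nsmul hb k
      exact ⟨fun _ => k • g, ⟨i, fun j => by simpa [Subsingleton.elim j 0] using hi.symm⟩, rfl⟩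
  have hinj : Function.Injective (fun w : Fin 1 → G => w 0) := fun v w hvw => by
    ext j; rw [Subsingleton.elim j 0]; exact hvw
  rw [factorComplexity, ← Set.ncard_image_of_injective _ hinj, him, ← Nat.card_addSubmonoidMultiples]
  rfl

/-- Decimation: a factor of phase `p` is determined by its letters at the `c` indices congruent to
`p` modulo `b`, and these spell an arbitrary factor of length `c`, shifted by `g`. -/
theorem ncard_phaseFactors (h : IsRulerWord b g e) {p N c : ℕ} (hp : p < b)
    (hc : ∀ x, p + b * x < N ↔ x < c) :
    (phaseFactors b e N p).ncard = factorComplexity e c := by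
  let Ψ : (Fin N → G) → (Fin c → G) := fun w x => w ⟨p + b * x, (hc x).2 x.2⟩ - g
  have him : Ψ '' phaseFactors b e N p = factorSet e c := by
    ext u
    constructor
    · rintro ⟨w, ⟨i, hi⟩, rfl⟩
      refine ⟨i, fun x => ?_⟩
      simp only [Ψ, hi, h.apply_special hp, add_sub_cancel_right]
    · rintro ⟨i, hi⟩
      refine ⟨fun j => e (b * i + (b - 1 - p) + j), ⟨i, fun _ => rfl⟩, ?_⟩
      ext x
      simp only [Ψ, h.apply_special hp, add_sub_cancel_right, hi]
  have hinj : Set.InjOn Ψ (phaseFactors b e N p) := by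
    rintro v ⟨i, hi⟩ w ⟨i', hi'⟩ hvw
    ext j
    by_cases hj : ∃ x, (j : ℕ) = p + b * x
    · obtain ⟨x, hx⟩ := hj
      have hxc : x < c := (hc x).1 (hx ▸ j.2)
      have h1 := congrFun hvw ⟨x, hxc⟩
      have h2 : j = ⟨p + b * x, (hc x).2 hxc⟩ := Fin.ext hx
      simp only [Ψ, sub_left_inj] at h1
      rw [h2]; exact h1
    · push Not at hj
      rw [hi, hi', h.apply_not_special hp _ _ hj, h.apply_not_special hp _ _ hj]
  rw [factorComplexity, ← him, hinj.ncard_image]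

/-- A window that sees at least two consecutive multiples of `b` sees one whose letter is `g ≠ 0`;
a window that sees at most one can be placed so that this letter vanishes. -/
theorem zero_mem_phaseFactors_iff [Finite G] (h : IsRulerWord b g e) (hb : 2 ≤ b) (hg : g ≠ 0)
    {p N c : ℕ} (hp : p < b) (hc : ∀ x, p + b * x < N ↔ x < c) :
    (0 : Fin N → G) ∈ phaseFactors b e N p ↔ c ≤ 1 := by
  constructor
  · rintro ⟨i, hi⟩
    by_contra! hc1
    have key : ∀ x, x < c → e (i + x) + g = 0 := fun x hx => by
      rw [← h.apply_special hp]
      exact (hi ⟨p + b * x, (hc x).2 hx⟩).symm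
    have k0 := key 0 (by omega)
    have k1 := key 1 (by omega)
    -- one of the positions `i`, `i + 1` is not congruent to `-1` modulo `b`
    have hr : i % b < b := Nat.mod_lt _ (by omega)
    have hd := Nat.div_add_mod i b
    by_cases hcase : i % b = b - 1
    · have : i + 1 = b * (i / b + 1) + 0 := by rw [mul_add]; omega
      rw [this, h.eq_zero _ _ (by omega), zero_add] at k1
      exact hg k1
    · rw [add_zero, ← hd, h.eq_zero _ _ (by omega), zero_add] at k0
      exact hg k0
  · intro hc1
    -- a position whose letter is `-g`
    obtain ⟨i, hi⟩ := h.exists_eq_nsmul hb (addOrderOf g - 1)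
    have hq : 0 < addOrderOf g := addOrderOf_pos g
    have hi' : e i + g = 0 := by
      rw [hi, ← succ_nsmul, Nat.sub_add_cancel hq, addOrderOf_nsmul_eq_zero]
    refine ⟨i, fun j => ?_⟩
    by_cases hj : ∃ x, (j : ℕ) = p + b * x
    · obtain ⟨x, hx⟩ := hj
      have hxc : x < c := (hc x).1 (hx ▸ j.2)
      obtain rfl : x = 0 := by omega
      rw [hx, h.apply_special hp, add_zero, hi']
      rfl
    · push Not at hj
      rw [h.apply_not_special hp _ _ hj]
      rfl

/-- A nonzero letter of a factor reveals the phase. -/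
theorem disjoint_phaseFactors (h : IsRulerWord b g e) (N : ℕ) {p p' : ℕ} (hp : p < b)
    (hp' : p' < b) (hne : p ≠ p') :
    Disjoint (phaseFactors b e N p \ {0}) (phaseFactors b e N p' \ {0}) := by
  rw [Set.disjoint_left]
  rintro w ⟨⟨i, hi⟩, hw⟩ ⟨⟨i', hi'⟩, -⟩
  apply hw
  rw [Set.mem_singleton_iff]
  ext j
  by_cases hj : ∃ x, (j : ℕ) = p + b * x
  · by_cases hj' : ∃ x, (j : ℕ) = p' + b * x
    · obtain ⟨x, hx⟩ := hj
      obtain ⟨x', hx'⟩ := hj'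
      refine absurd ?_ hne
      have h1 : (p + b * x) % b = (p' + b * x') % b := by rw [← hx, ← hx']
      simpa [Nat.add_mul_mod_self_left, Nat.mod_eq_of_lt, hp, hp'] using h1
    · push Not at hj'
      rw [hi', h.apply_not_special hp' _ _ hj']; rfl
  · push Not at hj
    rw [hi, h.apply_not_special hp _ _ hj]; rfl

/-- The factors of length `b * M + s` are sorted by phase: `s` phases see `M + 1` multiples of `b`
and `b - s` phases see `M`. Only the zero word can occur in several phases; it occurs in all the
phases that see at most one multiple, which accounts for the correction terms. -/
theorem factorComplexity_mul_add [Finite G] (h : IsRulerWord b g e) (hb : 2 ≤ b) (hg : g ≠ 0)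
    (M s : ℕ) (hs : s < b) :
    factorComplexity e (b * M + s)
        + (s * (if M = 0 then 1 else 0) + (b - s) * (if M ≤ 1 then 1 else 0))
      = s * factorComplexity e (M + 1) + (b - s) * factorComplexity e M
        + (if M ≤ 1 then 1 else 0) := by
  set N := b * M + s with hN
  let c : ℕ → ℕ := fun p => if p < s then M + 1 else M
  have hc : ∀ p < b, ∀ x, p + b * x < N ↔ x < c p := by
    intro p hp x
    have lt_of : ∀ y z : ℕ, y < z → b * y + b ≤ b * z := fun y z hyz => by
      calc b * y + b = b * (y + 1) := by ring
        _ ≤ b * z := Nat.mul_le_mul_left b hyz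
    simp only [c]
    rcases lt_trichotomy x M with hx | hx | hx
    · have := lt_of _ _ hx
      split_ifs <;> omega
    · subst hx
      split_ifs <;> omega
    · have := lt_of _ _ hx
      split_ifs <;> omega
  -- summing over the phases
  have hsum : ∀ f : ℕ → ℕ, ∑ p : Fin b, f (c p) = s * f (M + 1) + (b - s) * f M := by
    intro f
    rw [Fin.sum_univ_eq_sum_range (fun p => f (c p)) b]
    obtain ⟨d, rfl⟩ := Nat.exists_eq_add_of_le hs.le
    rw [Finset.sum_range_add]
    rw [Finset.sum_congr rfl (fun p hp => by
      rw [show c p = M + 1 from if_pos (Finset.mem_range.1 hp)] : ∀ p ∈ Finset.range s,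
        f (c p) = f (M + 1))]
    rw [Finset.sum_congr rfl (fun p _ => by
      rw [show c (s + p) = M from if_neg (by omega)] : ∀ p ∈ Finset.range d,
        f (c (s + p)) = f M)]
    simp
  have hunion : factorSet e N \ {0} = ⋃ p : Fin b, phaseFactors b e N p \ {0} := by
    rw [factorSet_eq_iUnion_phaseFactors hb, Set.iUnion_sdiff]
  have hcard : (factorSet e N \ {0}).ncard
      = ∑ p : Fin b, (phaseFactors b e N p \ {0}).ncard := by
    rw [hunion, Set.ncard_iUnion_of_finite (fun _ => Set.toFinite _)
      (fun p p' hne => h.disjoint_phaseFactors N p.2 p'.2 (fun h' => hne (Fin.ext h'))),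
      finsum_eq_sum_of_fintype]
  have hzero : (0 : Fin N → G) ∈ factorSet e N ↔ M ≤ 1 := by
    rw [factorSet_eq_iUnion_phaseFactors hb, Set.mem_iUnion]
    constructor
    · rintro ⟨p, hp⟩
      have := (h.zero_mem_phaseFactors_iff hb hg p.2 (hc p p.2)).1 hp
      simp only [c] at this
      split_ifs at this <;> omega
    · intro hM
      refine ⟨⟨b - 1, by omega⟩,
        (h.zero_mem_phaseFactors_iff hb hg (by omega) (hc (b - 1) (by omega))).2 ?_⟩
      simp only [c]
      rw [if_neg (by omega)]
      exact hM
  have h1 := ncard_diff_zero_add (factorSet e N) _ hzero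
  have h2 : ∑ p : Fin b, (phaseFactors b e N p \ {0}).ncard
      + ∑ p : Fin b, (if c p ≤ 1 then 1 else 0) = ∑ p : Fin b, factorComplexity e (c p) := by
    rw [← Finset.sum_add_distrib]
    refine Finset.sum_congr rfl fun p _ => ?_
    rw [ncard_diff_zero_add _ _ (h.zero_mem_phaseFactors_iff hb hg p.2 (hc p p.2)),
      h.ncard_phaseFactors p.2 (hc p p.2)]
  rw [hsum (fun k => if k ≤ 1 then 1 else 0), hsum (factorComplexity e), ← hcard] at h2
  have h3 : (if M + 1 ≤ 1 then 1 else 0) = (if M = 0 then 1 else 0) := by simp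
  rw [h3] at h2
  rw [show factorComplexity e N = (factorSet e N).ncard from rfl]
  omega

end IsRulerWord
/-! ### Closed forms for the complexity of a ruler word -/

namespace IsRulerWord

variable {G : Type*} [AddCommGroup G] [Finite G] {b : ℕ} {g : G} {e : ℕ → G}

theorem factorComplexity_of_le (h : IsRulerWord b g e) (hb : 2 ≤ b) (hg : g ≠ 0) {N : ℕ}
    (hN : N ≤ b) : (factorComplexity e N : ℤ) = ((addOrderOf g : ℤ) - 1) * N + 1 := by
  have h1 := h.factorComplexity_one hb
  have h0 := factorComplexity_zero e
  rcases hN.lt_or_eq with hN | rfl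
  · have := h.factorComplexity_mul_add hb hg 0 N hN
    simp only [mul_zero, zero_add, h0, h1] at this
    obtain ⟨d, rfl⟩ := Nat.exists_eq_add_of_le hN.le
    zify at this
    simp at this
    linarith
  · have := h.factorComplexity_mul_add hb hg 1 0 (by omega)
    simp only [h1] at this
    zify at this
    simp at this
    linarith

/-- An affine formula for the complexity on `[u, v]` scales to one on `[b * u, b * v]`, as soon as
all windows involved see at least two multiples of `b`. -/
theorem factorComplexity_affine_scale (h : IsRulerWord b g e) (hb : 2 ≤ b) (hg : g ≠ 0)
    {u v : ℕ} {α β : ℤ} (huv : ∀ N, u ≤ N → N ≤ v → (factorComplexity e N : ℤ) = α * N + β)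
    {N : ℕ} (hu : b * u ≤ N) (hv : N ≤ b * v) (h2 : 2 * b ≤ N) :
    (factorComplexity e N : ℤ) = α * N + b * β := by
  obtain ⟨M, s, hs, rfl⟩ : ∃ M s, s < b ∧ N = b * M + s :=
    ⟨N / b, N % b, Nat.mod_lt _ (by omega), (Nat.div_add_mod N b).symm⟩
  have hM2 : 2 ≤ M := by
    by_contra! hc
    have : b * M ≤ b * 1 := Nat.mul_le_mul_left b (by omega)
    omega
  have huM : u ≤ M := by
    by_contra! hc
    have : b * (M + 1) ≤ b * u := Nat.mul_le_mul_left b hc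
    rw [mul_add] at this
    omega
  have hMv : M ≤ v := Nat.le_of_mul_le_mul_left (by omega : b * M ≤ b * v) (by omega)
  have key := h.factorComplexity_mul_add hb hg M s hs
  rw [if_neg (by omega), if_neg (by omega)] at key
  obtain ⟨d, hd⟩ := Nat.exists_eq_add_of_le hs.le
  rw [show b - s = d by omega] at key
  zify at key hd
  have eM := huv M huM hMv
  rcases Nat.eq_zero_or_pos s with rfl | hs0
  · rw [eM] at key
    push_cast at key hd ⊢
    linear_combination key - (α * M + β) * hd
  · have hMv' : M + 1 ≤ v := by
      by_contra! hc
      have : b * v ≤ b * M := Nat.mul_le_mul_left b (by omega)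
      omega
    have eM' := huv (M + 1) (by omega) hMv'
    rw [eM, eM'] at key
    push_cast at key ⊢
    linear_combination key - (α * M + β) * hd

/-- On `[b, 2 * b - 1]` every additional letter turns a phase that sees one multiple of `b` into a
phase that sees two of them. -/
theorem factorComplexity_steep_base (h : IsRulerWord b g e) (hb : 2 ≤ b) (hg : g ≠ 0) {N : ℕ}
    (h1 : b ≤ N) (h2 : N < 2 * b) :
    (factorComplexity e N : ℤ) = addOrderOf g * N + -((b : ℤ) - 1) := by
  obtain ⟨s, rfl⟩ := Nat.exists_eq_add_of_le h1
  have key := h.factorComplexity_mul_add hb hg 1 s (by omega)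
  have e2 := h.factorComplexity_of_le hb hg hb
  rw [h.factorComplexity_one hb, mul_one] at key
  obtain ⟨d, hd⟩ := Nat.exists_eq_add_of_le (show s ≤ b by omega)
  rw [show b - s = d by omega] at key
  simp only [one_ne_zero, if_false, le_refl, if_true] at key
  norm_num at key
  zify at key hd
  push_cast at e2 ⊢
  rw [e2] at key
  linear_combination key + (1 - (addOrderOf g : ℤ)) * hd

/-- The pieces of slope `q`. -/
theorem factorComplexity_steep (h : IsRulerWord b g e) (hb : 2 ≤ b) (hg : g ≠ 0) (k : ℕ) {N : ℕ}
    (h1 : b ^ (k + 1) ≤ N) (h2 : N + b ^ k ≤ 2 * b ^ (k + 1)) :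
    (factorComplexity e N : ℤ) = addOrderOf g * N + -((b : ℤ) ^ (k + 1) - b ^ k) := by
  induction k generalizing N with
  | zero =>
    rw [h.factorComplexity_steep_base hb hg (by simpa using h1) (by simp at h2; omega)]
    simp
  | succ k ih =>
    have hk : b ^ (k + 1) = b * b ^ k := pow_succ' b k
    have hk2 : b ^ (k + 1 + 1) = b * b ^ (k + 1) := pow_succ' b (k + 1)
    have hbb : b * 2 ≤ b * b ^ (k + 1) :=
      Nat.mul_le_mul_left b (hb.trans (Nat.le_self_pow (by omega) b))
    rw [h.factorComplexity_affine_scale hb hg (u := b ^ (k + 1)) (v := 2 * b ^ (k + 1) - b ^ k)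
      (fun N hu hv => ih hu ?_) (by omega) ?_ (by omega)]
    · ring
    · rw [Nat.mul_sub, ← hk]
      have : b * (2 * b ^ (k + 1)) = 2 * b ^ (k + 1 + 1) := by rw [hk2]; ring
      omega
    · have : b ^ k ≤ b ^ (k + 1) := Nat.pow_le_pow_right (by omega) (by omega)
      omega

/-- The pieces of slope `q - 1`. The one on `[2 * b - 1, b ^ 2]` is the image of `[1, b]` under
scaling, except for its left end, which lies on the preceding steep piece. -/
theorem factorComplexity_flat (h : IsRulerWord b g e) (hb : 2 ≤ b) (hg : g ≠ 0) (k : ℕ) {N : ℕ}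
    (h1 : 2 * b ^ (k + 1) ≤ N + b ^ k) (h2 : N ≤ b ^ (k + 2)) :
    (factorComplexity e N : ℤ) = ((addOrderOf g : ℤ) - 1) * N + (b : ℤ) ^ (k + 1) := by
  induction k generalizing N with
  | zero =>
    simp only [zero_add, pow_one, pow_zero] at h1 h2 ⊢
    by_cases hN : 2 * b ≤ N
    · rw [h.factorComplexity_affine_scale hb hg (u := 1) (v := b)
        (fun N _ hv => h.factorComplexity_of_le hb hg hv) (by omega) (by rwa [← sq]) hN, mul_one]
    · obtain rfl : N = 2 * b - 1 := by omega
      rw [h.factorComplexity_steep_base hb hg (by omega) (by omega)]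
      push_cast [show 1 ≤ 2 * b by omega]
      ring
  | succ k ih =>
    have hk : b ^ (k + 1) = b * b ^ k := pow_succ' b k
    have hk2 : b ^ (k + 1 + 1) = b * b ^ (k + 1) := pow_succ' b (k + 1)
    have hk3 : b ^ (k + 1 + 2) = b * b ^ (k + 2) := pow_succ' b (k + 2)
    have hle : b ^ k ≤ b ^ (k + 1) := Nat.pow_le_pow_right (by omega) (by omega)
    have hle2 : b ^ (k + 1) ≤ b ^ (k + 1 + 1) := Nat.pow_le_pow_right (by omega) (by omega)
    have hbb : b * 2 ≤ b * b ^ (k + 1) :=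
      Nat.mul_le_mul_left b (hb.trans (Nat.le_self_pow (by omega) b))
    rw [h.factorComplexity_affine_scale hb hg (u := 2 * b ^ (k + 1) - b ^ k) (v := b ^ (k + 2))
      (fun N hu hv => ih (by omega) hv) ?_ (by omega) (by omega)]
    · ring
    · rw [Nat.mul_sub, ← hk]
      have : b * (2 * b ^ (k + 1)) = 2 * b ^ (k + 1 + 1) := by rw [hk2]; ring
      omega

end IsRulerWord

/-! ### Differences of the generalized Thue–Morse word -/

section gtm

variable {b m : ℕ}

theorem gtmWord_mul_add (hb : 2 ≤ b) (n r : ℕ) (hr : r < b) :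
    gtmWord b m (b * n + r) = gtmWord b m n + r := by
  unfold gtmWord
  rcases Nat.eq_zero_or_pos (b * n + r) with h0 | h0
  · obtain ⟨h1, rfl⟩ := Nat.add_eq_zero_iff.1 h0
    obtain rfl : n = 0 := (Nat.mul_eq_zero.1 h1).resolve_left (by omega)
    simp
  · rw [Nat.digits_def' (by omega) h0, Nat.mul_add_mod, Nat.mod_eq_of_lt hr,
      Nat.mul_add_div (by omega), Nat.div_eq_of_lt hr]
    simp [add_comm]

theorem gtmWord_add_pow_mul (hb : 2 ≤ b) (N x j : ℕ) (hx : x < b ^ N) :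
    gtmWord b m (x + b ^ N * j) = gtmWord b m x + gtmWord b m j := by
  induction N generalizing x with
  | zero =>
    obtain rfl : x = 0 := by simpa using hx
    simp [gtmWord]
  | succ N ih =>
    have hr : x % b < b := Nat.mod_lt _ (by omega)
    have hd := Nat.div_add_mod x b
    have hlt : x / b < b ^ N := Nat.div_lt_of_lt_mul (by rwa [← pow_succ'])
    have h1 : x + b ^ (N + 1) * j = b * (x / b + b ^ N * j) + x % b := by
      conv_lhs => rw [← hd]
      ring
    conv_rhs => rw [← hd]
    rw [h1, gtmWord_mul_add hb _ _ hr, gtmWord_mul_add hb _ _ hr, ih _ hlt]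
    ring

theorem gtmWord_surjective (hb : 2 ≤ b) [NeZero m] : Function.Surjective (gtmWord b m) := by
  intro c
  obtain ⟨k, rfl⟩ : ∃ k : ℕ, (k : ZMod m) = c := ⟨c.val, ZMod.natCast_zmod_val c⟩
  induction k with
  | zero => exact ⟨0, by simp [gtmWord]⟩
  | succ k ih =>
    obtain ⟨n, hn⟩ := ih
    exact ⟨b * n + 1, by rw [gtmWord_mul_add hb n 1 (by omega), hn]; push_cast; rfl⟩

/-- The differences of consecutive letters of the generalized Thue–Morse word, decreased by `1`. -/
def gtmDiff (b m : ℕ) (n : ℕ) : ZMod m :=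
  gtmWord b m (n + 1) - gtmWord b m n - 1

theorem isRulerWord_gtmDiff (hb : 2 ≤ b) :
    IsRulerWord b (1 - (b : ZMod m)) (gtmDiff b m) where
  eq_zero n r hr := by
    rw [gtmDiff, add_assoc, gtmWord_mul_add hb _ _ hr, gtmWord_mul_add hb _ _ (by omega)]
    push_cast
    ring
  eq_add n := by
    have h1 : b * n + (b - 1) + 1 = b * (n + 1) + 0 := by rw [mul_add]; omega
    rw [gtmDiff, gtmDiff, h1, gtmWord_mul_add hb _ _ (by omega),
      gtmWord_mul_add hb _ _ (by omega)]
    push_cast [show 1 ≤ b by omega]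
    ring

/-- A factor is given by its first letter and its differences; prefixing digits to the position of
an occurrence changes the first letter at will and preserves the differences. -/
theorem factorComplexity_gtmWord_succ (hb : 2 ≤ b) [NeZero m] (n : ℕ) :
    factorComplexity (gtmWord b m) (n + 1) = m * factorComplexity (gtmDiff b m) n := by
  let Ψ : (Fin (n + 1) → ZMod m) → ZMod m × (Fin n → ZMod m) :=
    fun w => (w 0, fun j => w j.succ - w j.castSucc - 1)
  have hinj : Function.Injective Ψ := by
    intro v w hvw
    simp only [Ψ, Prod.mk.injEq] at hvw
    ext j
    induction j using Fin.induction with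
    | zero => exact hvw.1
    | succ j ih =>
      have := congrFun hvw.2 j
      simp only [ih] at this
      exact sub_left_injective (sub_left_injective this)
  have him : Ψ '' factorSet (gtmWord b m) (n + 1)
      = Set.univ ×ˢ factorSet (gtmDiff b m) n := by
    ext ⟨c, u⟩
    simp only [Set.mem_prod, Set.mem_univ, true_and]
    constructor
    · rintro ⟨w, ⟨i, hi⟩, hw⟩
      simp only [Ψ, Prod.mk.injEq] at hw
      refine ⟨i, fun j => ?_⟩
      rw [← hw.2]
      simp only [hi, gtmDiff, Fin.val_succ, Fin.val_castSucc]
      rfl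
    · rintro ⟨i, hi⟩
      obtain ⟨j, hj⟩ := gtmWord_surjective (m := m) hb (c - gtmWord b m i)
      -- leading digits `j` above a block of `i + n + 1` digits
      set L := i + n + 1
      have hL : L < b ^ L := Nat.lt_pow_self hb
      have hshift : ∀ x ≤ n, gtmWord b m (i + b ^ L * j + x)
          = gtmWord b m (i + x) + (c - gtmWord b m i) := by
        intro x hx
        rw [← hj, ← gtmWord_add_pow_mul hb L (i + x) j (by omega)]
        congr 1
        ring
      refine ⟨fun x => gtmWord b m (i + b ^ L * j + x), ⟨_, fun _ => rfl⟩, ?_⟩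
      refine Prod.ext ?_ (funext fun x => ?_)
      · simp only [Ψ]
        rw [hshift _ (by simp)]
        simp
      · simp only [Ψ]
        have hx := x.2
        rw [hshift _ (by simp), hshift _ (by simp), hi]
        simp only [gtmDiff, Fin.val_succ, Fin.val_castSucc, add_assoc]
        ring
  rw [factorComplexity, ← Set.ncard_image_of_injective _ hinj, him, Set.ncard_prod,
    Set.ncard_univ, Nat.card_zmod, factorComplexity]

theorem addOrderOf_eq_gtmOrder : addOrderOf (1 - (b : ZMod m)) = gtmOrder b m := by
  have hneg : (1 - (b : ZMod m)) = -((b : ZMod m) - 1) := by ring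
  have hpow : ∀ (k : ℕ) (x : ZMod m), (gtmPerm b m ^ k) x = x + k • ((b : ZMod m) - 1) := by
    intro k
    induction k with
    | zero => simp
    | succ k ih =>
      intro x
      rw [pow_succ, Equiv.Perm.mul_apply, ih, succ_nsmul]
      simp only [gtmPerm, Equiv.coe_addRight]
      ring
  rw [hneg, addOrderOf_neg, gtmOrder]
  refine Nat.dvd_antisymm (addOrderOf_dvd_iff_nsmul_eq_zero.2 ?_) (orderOf_dvd_iff_pow_eq_one.2 ?_)
  · simpa [pow_orderOf_eq_one] using (hpow (orderOf (gtmPerm b m)) 0).symm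
  · ext x
    rw [hpow, addOrderOf_nsmul_eq_zero]
    simp

/-- If `m` divides `b - 1`, then `n` and its digit sum are congruent modulo `m`. -/
theorem isUltimatelyPeriodic_gtmWord (hb : 2 ≤ b) (hm : 1 ≤ m) (h0 : 1 - (b : ZMod m) = 0) :
    IsUltimatelyPeriodic (gtmWord b m) := by
  have hdiff : ∀ n, gtmWord b m (n + 1) = gtmWord b m n + 1 := by
    intro n
    obtain ⟨k, hk⟩ := (isRulerWord_gtmDiff (m := m) hb).mem_multiples hb n
    simp only [h0, smul_zero, gtmDiff] at hk
    linear_combination -hk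
  have hadd : ∀ n k : ℕ, gtmWord b m (n + k) = gtmWord b m n + k := by
    intro n k
    induction k with
    | zero => simp
    | succ k ih => rw [← add_assoc, hdiff, ih]; push_cast; ring
  exact ⟨0, m, hm, fun n _ => by rw [hadd, ZMod.natCast_self, add_zero]⟩

end gtm

/-! ### The first difference function -/

/-- The exponent `k` is determined by `b ^ (k + 1) ≤ n - 2 < b ^ (k + 2)`. -/
theorem exists_pow_bracket {b : ℕ} (hb : 2 ≤ b) {n : ℕ} (hn : b + 2 ≤ n) : ∃ k ℓ : ℕ, 1 ≤ ℓ ∧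
    (((ℓ : ℤ) ≤ (b : ℤ) ^ (k + 1) - (b : ℤ) ^ k ∧ (n : ℤ) = (b : ℤ) ^ (k + 1) + ℓ + 1) ∨
     ((ℓ : ℤ) ≤ (b : ℤ) ^ (k + 2) - 2 * (b : ℤ) ^ (k + 1) + (b : ℤ) ^ k ∧
      (n : ℤ) = 2 * (b : ℤ) ^ (k + 1) - (b : ℤ) ^ k + ℓ + 1)) := by
  have hpos : 1 ≤ Nat.log b (n - 2) := Nat.log_pos (by omega) (by omega)
  obtain ⟨k, hk⟩ := Nat.exists_eq_add_of_le' hpos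
  have h1 : b ^ (k + 1) ≤ n - 2 := by
    rw [← hk]; exact Nat.pow_log_le_self b (by omega)
  have h2 : n - 2 < b ^ (k + 2) := by
    have := Nat.lt_pow_succ_log_self (b := b) (by omega) (n - 2)
    rwa [hk] at this
  have hle : b ^ k ≤ b ^ (k + 1) := Nat.pow_le_pow_right (by omega) (by omega)
  by_cases hc : n - 1 + b ^ k ≤ 2 * b ^ (k + 1)
  · refine ⟨k, n - 1 - b ^ (k + 1), by omega, Or.inl ?_⟩
    zify [show b ^ (k + 1) ≤ n - 1 by omega, show 1 ≤ n by omega] at hc ⊢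
    constructor <;> linarith
  · refine ⟨k, n - 1 + b ^ k - 2 * b ^ (k + 1), by omega, Or.inr ?_⟩
    have h3 : n ≤ b ^ (k + 2) + 1 := by omega
    zify [show 2 * b ^ (k + 1) ≤ n - 1 + b ^ k by omega, show 1 ≤ n by omega] at h3 ⊢
    constructor <;> linarith

theorem mainTheorem5 (b m : ℕ) (hb : 2 ≤ b) (hm : 1 ≤ m)
    (haper : ¬ IsUltimatelyPeriodic (gtmWord b m))
    (q : ℕ) (hq : q = gtmOrder b m)
    (C : ℕ → ℕ) (hC : C = factorComplexity (gtmWord b m))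
    (Δ : ℕ → ℤ) (hΔ : Δ = firstDifference (gtmWord b m)) :
    -- for `n ≥ 2`, the values of `Δ(n)` are exactly `(q - 1) m` and `q m`
    Δ '' Set.Ici 2 = {((q : ℤ) - 1) * m, (q : ℤ) * m} ∧
    -- the row `n = 1`
    (Δ 1 = (m : ℤ) - 1 ∧ C 1 = m) ∧
    -- the row `2 ≤ n ≤ b + 1`
    (∀ n : ℕ, 2 ≤ n → n ≤ b + 1 →
      Δ n = ((q : ℤ) - 1) * m ∧
      (C n : ℤ) = (q : ℤ) * m * ((n : ℤ) - 1) - m * ((n : ℤ) - 2)) ∧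
    -- the row `n = b ^ (k + 1) + ℓ + 1`
    (∀ n k ℓ : ℕ, 1 ≤ ℓ → (ℓ : ℤ) ≤ (b : ℤ) ^ (k + 1) - (b : ℤ) ^ k →
      (n : ℤ) = (b : ℤ) ^ (k + 1) + ℓ + 1 →
      Δ n = (q : ℤ) * m ∧
      (C n : ℤ) = (q : ℤ) * m * ((n : ℤ) - 1) - m * ((b : ℤ) ^ (k + 1) - (b : ℤ) ^ k)) ∧
    -- the row `n = 2 b ^ (k + 1) - b ^ k + ℓ + 1`
    (∀ n k ℓ : ℕ, 1 ≤ ℓ →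
      (ℓ : ℤ) ≤ (b : ℤ) ^ (k + 2) - 2 * (b : ℤ) ^ (k + 1) + (b : ℤ) ^ k →
      (n : ℤ) = 2 * (b : ℤ) ^ (k + 1) - (b : ℤ) ^ k + ℓ + 1 →
      Δ n = ((q : ℤ) - 1) * m ∧
      (C n : ℤ) = (q : ℤ) * m * ((n : ℤ) - 1) -
        m * ((b : ℤ) ^ (k + 1) - (b : ℤ) ^ k + ℓ)) ∧
    -- the last two rows cover every `n ≥ b + 2`, so the rows together cover every `n ≥ 1`
    (∀ n : ℕ, b + 2 ≤ n → ∃ k ℓ : ℕ, 1 ≤ ℓ ∧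
      (((ℓ : ℤ) ≤ (b : ℤ) ^ (k + 1) - (b : ℤ) ^ k ∧
          (n : ℤ) = (b : ℤ) ^ (k + 1) + ℓ + 1) ∨
       ((ℓ : ℤ) ≤ (b : ℤ) ^ (k + 2) - 2 * (b : ℤ) ^ (k + 1) + (b : ℤ) ^ k ∧
          (n : ℤ) = 2 * (b : ℤ) ^ (k + 1) - (b : ℤ) ^ k + ℓ + 1))) := by
  have : NeZero m := ⟨by omega⟩
  set g : ZMod m := 1 - (b : ZMod m) with hgdef
  have hR : IsRulerWord b g (gtmDiff b m) := isRulerWord_gtmDiff hb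
  have hg : g ≠ 0 := fun h0 => haper (isUltimatelyPeriodic_gtmWord hb hm h0)
  have hqg : addOrderOf g = q := by rw [hq, ← addOrderOf_eq_gtmOrder]
  have hP : ∀ N, (C (N + 1) : ℤ) = m * factorComplexity (gtmDiff b m) N := by
    intro N
    rw [hC, factorComplexity_gtmWord_succ hb]
    push_cast
    rfl
  have hD : ∀ N, Δ (N + 1) = (C (N + 1) : ℤ) - C N := by
    intro N
    rw [hΔ, hC]
    rfl
  have hlow : ∀ N, N ≤ b → (C (N + 1) : ℤ) = m * (((q : ℤ) - 1) * N + 1) := fun N hN => by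
    rw [hP, hR.factorComplexity_of_le hb hg hN, hqg]
  have hsteep : ∀ k N, b ^ (k + 1) ≤ N → N + b ^ k ≤ 2 * b ^ (k + 1) →
      (C (N + 1) : ℤ) = m * (q * N + -((b : ℤ) ^ (k + 1) - b ^ k)) := fun k N h1 h2 => by
    rw [hP, hR.factorComplexity_steep hb hg k h1 h2, hqg]
  have hflat : ∀ k N, 2 * b ^ (k + 1) ≤ N + b ^ k → N ≤ b ^ (k + 2) →
      (C (N + 1) : ℤ) = m * (((q : ℤ) - 1) * N + (b : ℤ) ^ (k + 1)) := fun k N h1 h2 => by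
    rw [hP, hR.factorComplexity_flat hb hg k h1 h2, hqg]
  have row2 : ∀ n : ℕ, 2 ≤ n → n ≤ b + 1 →
      Δ n = ((q : ℤ) - 1) * m ∧
      (C n : ℤ) = (q : ℤ) * m * ((n : ℤ) - 1) - m * ((n : ℤ) - 2) := by
    intro n h1 h2
    obtain ⟨N, rfl⟩ := Nat.exists_eq_add_of_le' h1
    have e1 := hlow (N + 1) (by omega)
    have e0 := hlow N (by omega)
    rw [hD, e1, e0]
    push_cast
    constructor <;> ring
  have row3 : ∀ n k ℓ : ℕ, 1 ≤ ℓ → (ℓ : ℤ) ≤ (b : ℤ) ^ (k + 1) - (b : ℤ) ^ k →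
      (n : ℤ) = (b : ℤ) ^ (k + 1) + ℓ + 1 →
      Δ n = (q : ℤ) * m ∧
      (C n : ℤ) = (q : ℤ) * m * ((n : ℤ) - 1) - m * ((b : ℤ) ^ (k + 1) - (b : ℤ) ^ k) := by
    intro n k ℓ h1 h2 h3
    have h2' : ℓ + b ^ k ≤ b ^ (k + 1) := by zify; linarith
    have h3' : n = b ^ (k + 1) + ℓ + 1 := by exact_mod_cast h3
    obtain ⟨N, rfl⟩ := Nat.exists_eq_add_of_le' (show 2 ≤ n by omega)
    have e1 := hsteep k (N + 1) (by omega) (by omega)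
    have e0 := hsteep k N (by omega) (by omega)
    rw [hD, e1, e0]
    push_cast
    constructor <;> ring
  have row4 : ∀ n k ℓ : ℕ, 1 ≤ ℓ →
      (ℓ : ℤ) ≤ (b : ℤ) ^ (k + 2) - 2 * (b : ℤ) ^ (k + 1) + (b : ℤ) ^ k →
      (n : ℤ) = 2 * (b : ℤ) ^ (k + 1) - (b : ℤ) ^ k + ℓ + 1 →
      Δ n = ((q : ℤ) - 1) * m ∧
      (C n : ℤ) = (q : ℤ) * m * ((n : ℤ) - 1) -
        m * ((b : ℤ) ^ (k + 1) - (b : ℤ) ^ k + ℓ) := by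
    intro n k ℓ h1 h2 h3
    have h2' : ℓ + 2 * b ^ (k + 1) ≤ b ^ (k + 2) + b ^ k := by zify; linarith
    have h3' : n + b ^ k = 2 * b ^ (k + 1) + ℓ + 1 := by zify; linarith
    have hle : b ^ k ≤ b ^ (k + 1) := Nat.pow_le_pow_right (by omega) (by omega)
    have hpos : 0 < b ^ (k + 1) := Nat.pow_pos (by omega)
    obtain ⟨N, rfl⟩ := Nat.exists_eq_add_of_le' (show 2 ≤ n by omega)
    have e1 := hflat k (N + 1) (by omega) (by omega)
    have e0 := hflat k N (by omega) (by omega)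
    rw [hD, e1, e0]
    push_cast at h3 ⊢
    constructor
    · ring
    · linear_combination -(m : ℤ) * h3
  have cover : ∀ n : ℕ, b + 2 ≤ n → _ := fun n => exists_pow_bracket hb (n := n)
  have hC1 : C 1 = m := by
    have := hlow 0 (by omega)
    simpa using this
  refine ⟨?_, ⟨?_, hC1⟩, row2, row3, row4, cover⟩
  · ext z
    constructor
    · rintro ⟨n, hn, rfl⟩
      have hn2 : 2 ≤ n := hn
      rcases Nat.lt_or_ge (b + 1) n with h1 | h1
      · obtain ⟨k, ℓ, hℓ, ⟨h2, h3⟩ | ⟨h2, h3⟩⟩ := cover n h1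
        · exact Or.inr (row3 n k ℓ hℓ h2 h3).1
        · exact Or.inl (row4 n k ℓ hℓ h2 h3).1
      · exact Or.inl (row2 n hn2 h1).1
    · rintro (rfl | rfl)
      · exact ⟨2, Set.self_mem_Ici, (row2 2 le_rfl (by omega)).1⟩
      · refine ⟨b + 2, Set.mem_Ici.2 (by omega), (row3 (b + 2) 0 1 le_rfl ?_ ?_).1⟩
        · have : (2 : ℤ) ≤ b := by exact_mod_cast hb
          simp
          linarith
        · push_cast
          ring
  · rw [hD 0, hC1, hC, factorComplexity_zero]
    simp
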